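/- A finite graph is called $k$-critical if it has chromatic number $k$ and removing any edge makes it properly $(k-1)$-colorable; it is called critical if it is $k$-critical for some $k$. The odd-girth of a graph is the length of a shortest odd cycle ($\infty$ if there is none). For $k\ge 4$ let $c_k$ be the supremum of the real numbers $c$ such that there are infinitely many (pairwise non-isomorphic) $k$-critical graphs of odd-girth greater than $3$ (that is, triangle-free), each with more than $cn^2$ edges, where $n$ denotes its number of vertices. **Theorem.** There are a constant $c>0$ and a family of triangle-free critical graphs, each with more than $cn^2$ edges, where $n$ denotes its number of vertices, such that for every $k\ge 4$ the family contains infinitely many (pairwise non-isomorphic) graphs of chromatic number $k$. Moreover, for every $k\ge 4$ the supremum $c_k$ is taken over a non-empty set that is bounded above, and $$c_4\ge \tfrac1{16},\qquad c_5\ge \tfrac4{31},\qquad c_k=\tfrac14\quad\text{for all } k\ge 6 .$$ -/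

import Mathlib

namespace CriticalDensity

/-- A graph is `k`-critical if it has chromatic number `k`, and removing any edge allows it to be
properly `(k-1)`-colored. -/
def IsKCritical {V : Type*} (G : SimpleGraph V) (k : ℕ) : Prop :=
  G.chromaticNumber = (k : ℕ∞) ∧ ∀ e ∈ G.edgeSet, (G.deleteEdges {e}).Colorable (k - 1)

/-- The odd-girth of a graph: the length of a shortest odd cycle (`⊤` if there is none). -/
noncomputable def oddGirth {V : Type*} (G : SimpleGraph V) : ℕ∞ :=
  ⨅ (a : V) (w : G.Walk a a) (_ : w.IsCycle) (_ : Odd w.length), (w.length : ℕ∞)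

/-- Finite graphs, represented on the vertex sets `Fin n`. Every finite graph is isomorphic to one
of these, and each isomorphism class has only finitely many representatives, so that an infinite
set of such graphs contains infinitely many pairwise non-isomorphic graphs. -/
abbrev FinGraph : Type := Σ n : ℕ, SimpleGraph (Fin n)

/-- `G` has more than `c * n ^ 2` edges, where `n` is its number of vertices. -/
def HasMoreEdges (c : ℝ) (G : FinGraph) : Prop :=
  c * (G.1 : ℝ) ^ 2 < (G.2.edgeSet.ncard : ℝ)

/-- The constants `c` such that there is an infinite family of `k`-critical graphs of
odd-girth `> ℓ`, each with `> c * n ^ 2` edges. -/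
def densitySet (ℓ k : ℕ) : Set ℝ :=
  {c : ℝ | ∃ F : Set FinGraph, F.Infinite ∧
    ∀ G ∈ F, IsKCritical G.2 k ∧ (ℓ : ℕ∞) < oddGirth G.2 ∧ HasMoreEdges c G}

/-- The density constant `c_{ℓ,k}`, the supremum of `densitySet ℓ k`. -/
noncomputable def densityConst (ℓ k : ℕ) : ℝ := sSup (densitySet ℓ k)

end CriticalDensity

/-!
The graphs are built from two halves. Fix `K = k - 1` colors and `r + s = K - 1` with `r, s ≥ 1`.
A half with parameter `r` consists of disjoint triangle-free critical graphs `X 0, …, X (r - 1)`,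
where `X t` has chromatic number `K - t`, and of one apex vertex for each transversal, adjacent to
the `r` vertices of that transversal (`towerGraph`). In any `K`-coloring, `X t` misses at most `t`
colors, so a greedy choice gives, for any `r` colors, a transversal that shows all of them; its apex
vertex has yet another color. Hence the independent set of apex vertices receives more than `r`
colors, and it does so critically: if `X t` is colored with the colors `≥ t`, the color `t` being
used once, then exactly one transversal shows all the colors `< r`, and none does after an edge of
some `X t` is removed (`isForcing_towerGraph`).

Joining the apex vertices of two halves with parameters `r` and `s` completely to each other gives
a triangle-free `k`-critical graph: the two sets of apex vertices would need
`(r + 1) + (s + 1) = K + 1` colors (`isTriangleFreeCritical_joinGraph`).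

If `r ≥ 2`, the apex vertices vastly outnumber the other vertices of their half, as their number is
a product and not a sum. For `k ≥ 6` both parameters can be at least `2`, and a balanced choice gives
almost `n ^ 2 / 4` edges, which is optimal by Mantel's theorem. For `k = 4` both parameters are `1`,
which gives two odd cycles matched to the sides of a complete bipartite graph and `n ^ 2 / 16` edges.
For `k = 5` the parameters are `2` and `1`; the half with parameter `1` is taken over a dense
4-critical graph, whose edges are counted as well, and optimizing the sizes gives the density
`4 / 31`. Approximately prescribed sizes are available because, for each `k ≥ 3`, the numbers of
vertices of triangle-free `k`-critical graphs have bounded gaps (`hasBoundedGaps`).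
-/

namespace CriticalDensity

open Finset

variable {V W : Type*}

/-! ### Proper colorings by natural numbers -/

/-- `f` is a proper coloring of `G`, with natural numbers as colors. -/
def IsProper (G : SimpleGraph V) (f : V → ℕ) : Prop :=
  ∀ ⦃u v⦄, G.Adj u v → f u ≠ f v

theorem colorable_iff_exists_isProper {G : SimpleGraph V} {n : ℕ} :
    G.Colorable n ↔ ∃ f, IsProper G f ∧ ∀ v, f v < n := by
  rw [SimpleGraph.colorable_iff_exists_bdd_nat_coloring]
  constructor
  · rintro ⟨C, hC⟩
    exact ⟨C, fun _ _ h => C.valid h, hC⟩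
  · rintro ⟨f, hf, hn⟩
    exact ⟨SimpleGraph.Coloring.mk f fun {u v} h => hf h, hn⟩

theorem IsProper.colorable_card_image [Fintype V] {G : SimpleGraph V} {f : V → ℕ}
    (hf : IsProper G f) : G.Colorable #(univ.image f) := by
  have C : G.Coloring (univ.image f) :=
    SimpleGraph.Coloring.mk (fun v => ⟨f v, mem_image_of_mem f (mem_univ v)⟩)
      fun {u v} h e => hf h (congrArg Subtype.val e)
  simpa using C.colorable

theorem isProper_deleteEdges_iff {G : SimpleGraph V} {f : V → ℕ} {x y : V} :
    IsProper (G.deleteEdges {s(x, y)}) f ↔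
      ∀ ⦃u v⦄, G.Adj u v → f u = f v → s(u, v) = s(x, y) := by
  simp only [IsProper, SimpleGraph.deleteEdges_adj, Set.mem_singleton_iff]
  exact ⟨fun h u v huv e => by_contra fun hne => h ⟨huv, hne⟩ e,
    fun h u v huv e => huv.2 (h huv.1 e)⟩

theorem cliqueFree_three_iff {G : SimpleGraph V} :
    G.CliqueFree 3 ↔ ∀ a b c, G.Adj a b → G.Adj a c → ¬ G.Adj b c := by
  classical
  constructor
  · intro h a b c hab hac hbc
    exact h _ (SimpleGraph.is3Clique_triple_iff.2 ⟨hab, hac, hbc⟩)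
  · intro h s hs
    obtain ⟨a, b, c, hab, hac, hbc, -⟩ := SimpleGraph.is3Clique_iff.1 hs
    exact h a b c hab hac hbc

/-! ### Triangle-free critical graphs without isolated vertices -/

/-- A triangle-free `k`-critical graph with no isolated vertices. Edge-criticality says nothing about
isolated vertices, and excluding them makes the graph vertex-critical as well. -/
structure IsTriangleFreeCritical (G : SimpleGraph V) (k : ℕ) : Prop where
  cliqueFree : G.CliqueFree 3
  not_colorable : ¬ G.Colorable (k - 1)
  colorable_deleteEdges : ∀ u v, G.Adj u v → (G.deleteEdges {s(u, v)}).Colorable (k - 1)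
  exists_adj : ∀ v, ∃ w, G.Adj v w

namespace IsTriangleFreeCritical

variable {G : SimpleGraph V} {k : ℕ}

theorem nonempty (h : IsTriangleFreeCritical G k) : Nonempty V := by
  by_contra hV
  rw [not_nonempty_iff] at hV
  exact h.not_colorable (SimpleGraph.Colorable.of_isEmpty _)

/-- Vertex-criticality: some color of an optimal coloring is used only at the given vertex. The
colors are `t, …, t + k - 1`, and `t` is the one used once. -/
theorem exists_isProper_vertex (h : IsTriangleFreeCritical G k) (v : V) (t : ℕ) :
    ∃ f, IsProper G f ∧ (∀ u, f u < t + k) ∧ (∀ u, t ≤ f u) ∧ f v = t ∧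
      ∀ u, f u = t → u = v := by
  classical
  obtain ⟨w, hvw⟩ := h.exists_adj v
  obtain ⟨g, hg, hgk⟩ := colorable_iff_exists_isProper.1 (h.colorable_deleteEdges v w hvw)
  rw [isProper_deleteEdges_iff] at hg
  refine ⟨fun u => if u = v then t else t + (g u + 1), ?_, ?_, ?_, if_pos rfl, ?_⟩
  · intro a b hab
    have := hab.ne
    have hg' := @hg a b hab
    dsimp only
    split_ifs with ha hb hb
    · exact absurd (ha.trans hb.symm) this
    · omega
    · omega
    · intro e
      have := hg' (by omega)
      rcases Sym2.eq_iff.1 this with h | h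
      · exact ha h.1
      · exact hb h.2
  · intro u
    have := hgk u
    dsimp only
    split_ifs <;> omega
  · intro u
    dsimp only
    split_ifs <;> omega
  · intro u
    dsimp only
    split_ifs with hu
    · exact fun _ => hu
    · omega

/-- After the removal of an edge, the `k - 1` colors `t + 1, …, t + k - 1` suffice. -/
theorem exists_isProper_edge (h : IsTriangleFreeCritical G k) {x y : V} (hxy : G.Adj x y)
    (t : ℕ) : ∃ f, IsProper (G.deleteEdges {s(x, y)}) f ∧ (∀ u, f u < t + k) ∧ ∀ u, t < f u := by
  obtain ⟨g, hg, hgk⟩ := colorable_iff_exists_isProper.1 (h.colorable_deleteEdges x y hxy)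
  refine ⟨fun u => t + (g u + 1), fun a b hab e => hg hab ?_, fun u => ?_, fun u => ?_⟩
  · dsimp only at e
    omega
  · have := hgk u
    dsimp only
    omega
  · dsimp only
    omega

theorem card_image_ge [Fintype V] (h : IsTriangleFreeCritical G k) {f : V → ℕ}
    (hf : IsProper G f) : k ≤ #(univ.image f) := by
  by_contra hlt
  exact h.not_colorable (hf.colorable_card_image.mono (by omega))

theorem chromaticNumber_eq (h : IsTriangleFreeCritical G k) : G.chromaticNumber = k := by
  obtain ⟨v⟩ := h.nonempty
  obtain ⟨f, hf, hfk, -, -, -⟩ := h.exists_isProper_vertex v 0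
  have hk := hfk v
  obtain ⟨m, rfl⟩ : ∃ m, k = m + 1 := ⟨k - 1, by omega⟩
  push_cast
  rw [SimpleGraph.chromaticNumber_eq_iff_colorable_not_colorable]
  exact ⟨colorable_iff_exists_isProper.2 ⟨f, hf, by simpa using hfk⟩, by
    simpa using h.not_colorable⟩

theorem isKCritical (h : IsTriangleFreeCritical G k) : IsKCritical G k := by
  refine ⟨h.chromaticNumber_eq, fun e => ?_⟩
  induction e with
  | _ u v => exact h.colorable_deleteEdges u v

theorem of_iso {H : SimpleGraph W} (h : IsTriangleFreeCritical G k) (φ : G ≃g H) :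
    IsTriangleFreeCritical H k where
  cliqueFree := by
    have := cliqueFree_three_iff.1 h.cliqueFree
    exact cliqueFree_three_iff.2 fun a b c hab hac hbc => this _ _ _ (φ.symm.map_adj_iff.2 hab)
      (φ.symm.map_adj_iff.2 hac) (φ.symm.map_adj_iff.2 hbc)
  not_colorable hc := h.not_colorable ((SimpleGraph.colorable_congr φ).2 hc)
  colorable_deleteEdges u v huv := by
    obtain ⟨f, hf, hfk⟩ := colorable_iff_exists_isProper.1
      (h.colorable_deleteEdges (φ.symm u) (φ.symm v) (φ.symm.map_adj_iff.2 huv))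
    refine colorable_iff_exists_isProper.2 ⟨f ∘ φ.symm, ?_, fun w => hfk _⟩
    rw [isProper_deleteEdges_iff] at hf ⊢
    intro a b hab e
    have := hf (φ.symm.map_adj_iff.2 hab) e
    simpa using congrArg (Sym2.map φ) this
  exists_adj v := by
    obtain ⟨w, hw⟩ := h.exists_adj (φ.symm v)
    exact ⟨φ w, by simpa using φ.map_adj_iff.2 hw⟩

end IsTriangleFreeCritical

/-! ### Odd cycles -/

theorem isTriangleFreeCritical_cycleGraph (m : ℕ) :
    IsTriangleFreeCritical (SimpleGraph.cycleGraph (2 * m + 5)) 3 where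
  cliqueFree := by
    rw [cliqueFree_three_iff]
    intro a b c hab hac hbc
    rw [SimpleGraph.cycleGraph_adj'] at hab hac hbc
    simp only [Fin.sub_def] at hab hac hbc
    have ha := a.isLt
    have hb := b.isLt
    have hc := c.isLt
    have key : ∀ x y : ℕ, x < 2 * m + 5 → y < 2 * m + 5 → (2 * m + 5 - x + y) % (2 * m + 5) = 1 →
        y = x + 1 ∨ x = y + (2 * m + 4) := by
      intro x y hx hy h
      rcases Nat.lt_or_ge y x with hxy | hxy
      · rw [Nat.mod_eq_of_lt (by omega)] at h
        omega
      · rw [Nat.mod_eq_sub_mod (by omega), Nat.mod_eq_of_lt (by omega)] at h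
        omega
    have := hab.imp (key _ _ hb ha) (key _ _ ha hb)
    have := hac.imp (key _ _ hc ha) (key _ _ ha hc)
    have := hbc.imp (key _ _ hc hb) (key _ _ hb hc)
    omega
  not_colorable h := by
    have := SimpleGraph.chromaticNumber_cycleGraph_of_odd (2 * m + 5) (by omega) ⟨m + 2, by ring⟩
    have h2 := h.chromaticNumber_le
    rw [this] at h2
    exact absurd h2 (by decide)
  colorable_deleteEdges u v huv := by
    -- Cut open at the edge, the cycle is a path, colored by the parity of the position.
    have main : ∀ u v : Fin (2 * m + 3 + 2), v - u = 1 →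
        ((SimpleGraph.cycleGraph (2 * m + 5)).deleteEdges {s(u, v)}).Colorable (3 - 1) := by
      intro u v huv
      refine colorable_iff_exists_isProper.2 ⟨fun w => (w - v).val % 2, ?_, fun w =>
        Nat.mod_lt _ (by norm_num)⟩
      rw [isProper_deleteEdges_iff]
      have step : ∀ a b : Fin (2 * m + 3 + 2), b - a = 1 →
          (a - v).val % 2 = (b - v).val % 2 → a = u ∧ b = v := by
        intro a b hab e
        have hb : b - v = (a - v) + 1 := by rw [← hab]; abel
        rw [hb, Fin.val_add_one] at e
        split_ifs at e with hlast
        · have : b - v = 0 := by rw [hb, hlast]; simp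
          have hbv : b = v := sub_eq_zero.1 this
          refine ⟨?_, hbv⟩
          rw [hbv, ← huv] at hab
          exact sub_right_injective hab
        · omega
      intro a b hab e
      rcases SimpleGraph.cycleGraph_adj.1 hab with h | h
      · obtain ⟨rfl, rfl⟩ := step b a h e.symm
        exact Sym2.eq_swap
      · obtain ⟨rfl, rfl⟩ := step a b h e
        rfl
    rcases SimpleGraph.cycleGraph_adj.1 huv with h | h
    · rw [Sym2.eq_swap]
      exact main v u h
    · exact main u v h
  exists_adj v := ⟨(v + 1 : Fin (2 * m + 3 + 2)),
    SimpleGraph.cycleGraph_adj.2 (Or.inr (add_sub_cancel_left v 1))⟩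

/-! ### Sets that need many colors -/

/-- In every proper coloring of `G` with the colors `0, …, K - 1`, the independent set `B` receives
more than `r` colors (`exists_notMem`), and `G` is critical for this property: the colors `< r`
suffice on `B` except at one vertex, which may be prescribed (`exists_vertex`), and they suffice on
all of `B` once an edge is removed (`exists_edge`). -/
structure IsForcing (G : SimpleGraph V) (B : Set V) (K r : ℕ) : Prop where
  cliqueFree : G.CliqueFree 3
  indep : ∀ b ∈ B, ∀ c ∈ B, ¬ G.Adj b c
  nonempty : B.Nonempty
  exists_adj : ∀ v, ∃ w, G.Adj v w
  exists_notMem : ∀ f, IsProper G f → (∀ v, f v < K) → ∀ S : Finset ℕ, #S ≤ r → ∃ b ∈ B, f b ∉ S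
  exists_vertex : ∀ b ∈ B, ∃ f, IsProper G f ∧ (∀ v, f v < K) ∧ f b = r ∧
    ∀ c ∈ B, c ≠ b → f c < r
  exists_edge : ∀ u v, G.Adj u v → ∃ f, IsProper (G.deleteEdges {s(u, v)}) f ∧ (∀ v, f v < K) ∧
    ∀ b ∈ B, f b < r

theorem IsForcing.lt_card_colors {G : SimpleGraph V} {B : Set V} {K r : ℕ}
    (h : IsForcing G B K r) {f : V → ℕ} (hf : IsProper G f) (hK : ∀ v, f v < K) {S : Finset ℕ}
    (hS : ∀ b ∈ B, f b ∈ S) : r < #S := by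
  by_contra hr
  obtain ⟨b, hb, hbS⟩ := h.exists_notMem f hf hK S (by omega)
  exact hbS (hS b hb)

/-! ### Apex vertices over a tower of critical graphs -/

/-- The adjacency relation of `towerGraph`. -/
inductive TowerAdj {r : ℕ} {V : Fin r → Type*} (X : ∀ t, SimpleGraph (V t)) :
    (Σ t, V t) ⊕ (∀ t, V t) → (Σ t, V t) ⊕ (∀ t, V t) → Prop
  | base (t : Fin r) (x y : V t) (h : (X t).Adj x y) : TowerAdj X (.inl ⟨t, x⟩) (.inl ⟨t, y⟩)
  | up (z : ∀ t, V t) (t : Fin r) : TowerAdj X (.inl ⟨t, z t⟩) (.inr z)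
  | down (z : ∀ t, V t) (t : Fin r) : TowerAdj X (.inr z) (.inl ⟨t, z t⟩)

/-- The disjoint union of the graphs `X t`, together with one apex vertex for each transversal `z`,
adjacent to the vertices `z t`. -/
def towerGraph {r : ℕ} {V : Fin r → Type*} (X : ∀ t, SimpleGraph (V t)) :
    SimpleGraph ((Σ t, V t) ⊕ (∀ t, V t)) where
  Adj := TowerAdj X
  symm := ⟨by
    rintro _ _ (⟨t, x, y, h⟩ | ⟨z, t⟩ | ⟨z, t⟩)
    · exact .base t y x h.symm
    · exact .down z t
    · exact .up z t⟩
  loopless := ⟨by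
    rintro (⟨t, x⟩ | z) h
    · cases h with
      | base _ _ _ h => exact h.ne rfl
    · cases h⟩

/-- If the `t`-th of `n` sets misses at most `t` of the colors `0, …, K - 1`, then any `n` of these
colors are hit by a transversal of the sets. -/
theorem exists_transversal {K : ℕ} : ∀ {n : ℕ} (A : Fin n → Finset ℕ), n ≤ K →
    (∀ t, A t ⊆ range K) → (∀ t : Fin n, K - t ≤ #(A t)) →
    ∀ S ⊆ range K, #S ≤ n → ∃ a : Fin n → ℕ, (∀ t, a t ∈ A t) ∧ ∀ c ∈ S, ∃ t, a t = c
  | 0, A, _, _, _, S, _, hS => by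
    have : S = ∅ := by simpa using hS
    subst this
    exact ⟨fun t => 0, fun t => t.elim0, by simp⟩
  | n + 1, A, hn, hA, hcard, S, hSK, hS => by
    have hlast := hcard (Fin.last n)
    rw [Fin.val_last] at hlast
    -- The last set meets `S` if `S` has `n + 1` elements; otherwise any of its elements will do.
    obtain ⟨c, hc, hcS⟩ : ∃ c ∈ A (Fin.last n), #(S.erase c) ≤ n := by
      by_cases hd : Disjoint S (A (Fin.last n))
      · have h1 := card_le_card (union_subset hSK (hA (Fin.last n)))
        rw [card_union_of_disjoint hd, card_range] at h1
        obtain ⟨c, hc⟩ := card_pos.1 (show 0 < #(A (Fin.last n)) by omega)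
        exact ⟨c, hc, (card_le_card (erase_subset _ _)).trans (by omega)⟩
      · obtain ⟨c, hcS, hc⟩ := not_disjoint_iff.1 hd
        exact ⟨c, hc, by rw [card_erase_of_mem hcS]; omega⟩
    obtain ⟨a, ha, haS⟩ := exists_transversal (fun t => A t.castSucc) (by omega)
      (fun t => hA _) (fun t => by simpa using hcard t.castSucc) (S.erase c)
      ((erase_subset _ _).trans hSK) hcS
    refine ⟨Fin.snoc (α := fun _ => ℕ) a c, fun t => ?_, fun d hd => ?_⟩
    · refine Fin.lastCases ?_ (fun t => ?_) t
      · simpa using hc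
      · simpa using ha t
    · by_cases hdc : d = c
      · exact ⟨Fin.last n, by simp [hdc]⟩
      · obtain ⟨t, ht⟩ := haS d (mem_erase.2 ⟨hdc, hd⟩)
        exact ⟨t.castSucc, by simpa using ht⟩

/-- A triangularity argument: if `t ≤ h t` for all `t` and every color below `r` is a value of `h`,
then `h` is the identity. -/
theorem eq_of_forall_exists_eq {r : ℕ} {h : Fin r → ℕ} (hle : ∀ t : Fin r, (t : ℕ) ≤ h t)
    (hit : ∀ c < r, ∃ t, h t = c) (t : Fin r) : h t = t := by
  obtain ⟨c, hc⟩ := t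
  induction c using Nat.strong_induction_on with
  | _ c ih =>
    obtain ⟨t, ht⟩ := hit c hc
    rcases (ht ▸ hle t : (t : ℕ) ≤ c).lt_or_eq with hlt | heq
    · exact absurd ((ih t hlt t.isLt).symm.trans ht) hlt.ne
    · have : t = ⟨c, hc⟩ := Fin.ext heq
      rw [← this, ht, heq]

theorem exists_lt_forall_ne {r : ℕ} {V : Fin r → Type*} {g : ∀ t, V t → ℕ}
    (hle : ∀ (t : Fin r) x, (t : ℕ) ≤ g t x) (w : ∀ t, V t) (hw : ∃ t, g t (w t) ≠ t) :
    ∃ c < r, ∀ t, g t (w t) ≠ c := by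
  by_contra! h
  obtain ⟨t, ht⟩ := hw
  exact ht (eq_of_forall_exists_eq (fun t => hle t (w t)) h t)

section Tower

variable {r : ℕ} {V : Fin r → Type*} {X : ∀ t, SimpleGraph (V t)}

/-- A coloring of the whole tower, from colorings of the graphs `X t` and of the apex vertices. -/
def towerColoring (g : ∀ t, V t → ℕ) (β : (∀ t, V t) → ℕ) : (Σ t, V t) ⊕ (∀ t, V t) → ℕ :=
  Sum.elim (fun p => g p.1 p.2) β

theorem isProper_deleteEdges_towerColoring {g : ∀ t, V t → ℕ} {β : (∀ t, V t) → ℕ}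
    {p q : (Σ t, V t) ⊕ (∀ t, V t)}
    (hg : ∀ t x y, (X t).Adj x y → g t x = g t y → s(.inl ⟨t, x⟩, .inl ⟨t, y⟩) = s(p, q))
    (hβ : ∀ z t, g t (z t) = β z → s(.inl ⟨t, z t⟩, .inr z) = s(p, q)) :
    IsProper ((towerGraph X).deleteEdges {s(p, q)}) (towerColoring g β) := by
  rw [isProper_deleteEdges_iff]
  rintro _ _ (⟨t, x, y, h⟩ | ⟨z, t⟩ | ⟨z, t⟩) e
  · exact hg t x y h e
  · exact hβ z t e
  · rw [Sym2.eq_swap]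
    exact hβ z t e.symm

theorem isProper_towerColoring {g : ∀ t, V t → ℕ} {β : (∀ t, V t) → ℕ}
    (hg : ∀ t, IsProper (X t) (g t)) (hβ : ∀ z t, g t (z t) ≠ β z) :
    IsProper (towerGraph X) (towerColoring g β) := by
  rintro _ _ (⟨t, x, y, h⟩ | ⟨z, t⟩ | ⟨z, t⟩)
  · exact hg t h
  · exact hβ z t
  · exact (hβ z t).symm

/-- The neighbors of an apex vertex lie in distinct graphs `X t`. -/
theorem not_adj_of_adj_apex {z : ∀ t, V t} {p q : (Σ t, V t) ⊕ (∀ t, V t)}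
    (hp : (towerGraph X).Adj (.inr z) p) (hq : (towerGraph X).Adj (.inr z) q) :
    ¬ (towerGraph X).Adj p q := by
  rcases hp with _ | _ | ⟨_, t⟩
  rcases hq with _ | _ | ⟨_, t'⟩
  intro h
  have htt : t = t' := by
    generalize hu : z t = u at h
    generalize hv : z t' = v at h
    cases h
    rfl
  subst htt
  exact h.ne rfl

theorem cliqueFree_towerGraph (hX : ∀ t, (X t).CliqueFree 3) : (towerGraph X).CliqueFree 3 := by
  rw [cliqueFree_three_iff]
  rintro (a | a) (b | b) (c | c) hab hac hbc
  · rcases hab with ⟨t, x, y, h⟩ | _ | _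
    rcases hac with ⟨_, _, z, h'⟩ | _ | _
    rcases hbc with ⟨_, _, _, h''⟩ | _ | _
    exact cliqueFree_three_iff.1 (hX t) _ _ _ h h' h''
  · exact not_adj_of_adj_apex hac.symm hbc.symm hab
  · exact not_adj_of_adj_apex hab.symm hbc hac
  · exact not_adj_of_adj_apex hab.symm hbc hac
  all_goals exact not_adj_of_adj_apex hab hac hbc

variable [∀ t, Fintype (V t)] {K : ℕ}

theorem exists_apex_notMem (hrK : r ≤ K) (hX : ∀ t : Fin r, IsTriangleFreeCritical (X t) (K - t))
    {f : (Σ t, V t) ⊕ (∀ t, V t) → ℕ} (hf : IsProper (towerGraph X) f) (hK : ∀ v, f v < K)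
    {S : Finset ℕ} (hS : #S ≤ r) : ∃ z, f (.inr z) ∉ S := by
  classical
  obtain ⟨a, ha, haS⟩ := exists_transversal (K := K)
    (fun t => univ.image fun x : V t => f (.inl ⟨t, x⟩)) hrK
    (fun t c hc => by
      obtain ⟨x, -, rfl⟩ := mem_image.1 hc
      exact mem_range.2 (hK _))
    (fun t => (hX t).card_image_ge fun x y h => hf (.base t x y h))
    (S.filter (· < K)) (fun c hc => mem_range.2 (mem_filter.1 hc).2)
    ((card_filter_le _ _).trans hS)
  simp only [mem_image, mem_univ, true_and] at ha
  choose z hz using ha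
  refine ⟨z, fun hmem => ?_⟩
  obtain ⟨t, ht⟩ := haS _ (mem_filter.2 ⟨hmem, hK _⟩)
  exact hf (TowerAdj.up z t) ((hz t).trans ht)

/-- If the `t`-th graph has chromatic number `K - t`, its vertices miss at most `t` of `K` colors,
so for any `r` colors some transversal shows all of them, and its apex vertex avoids them. If the
graph `X t` uses only the colors `≥ t`, and the color `t` only once, there is just one transversal
that shows all the colors `< r`. -/
theorem isForcing_towerGraph (hr : 0 < r) (hrK : r < K)
    (hX : ∀ t : Fin r, IsTriangleFreeCritical (X t) (K - t)) :
    IsForcing (towerGraph X) (Set.range Sum.inr) K r := by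
  classical
  have z₀ : ∀ t, V t := fun t => (hX t).nonempty.some
  have hcol : ∀ z : ∀ t, V t, ∃ g : ∀ t, V t → ℕ, (∀ t, IsProper (X t) (g t)) ∧
      (∀ t x, g t x < K) ∧ (∀ (t : Fin r) x, (t : ℕ) ≤ g t x) ∧ (∀ t, g t (z t) = t) ∧
      ∀ w, w ≠ z → ∃ t, g t (w t) ≠ t := by
    intro z
    choose g hg hgK hgle hgz hgt using fun t => (hX t).exists_isProper_vertex (z t) t
    refine ⟨g, hg, fun t x => (hgK t x).trans_eq (by omega), hgle, hgz, fun w hw => ?_⟩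
    by_contra! h
    exact hw (funext fun t => hgt t _ (h t))
  refine ⟨cliqueFree_towerGraph fun t => (hX t).cliqueFree, ?_, ⟨_, z₀, rfl⟩, ?_, ?_, ?_, ?_⟩
  · rintro _ ⟨z, rfl⟩ _ ⟨w, rfl⟩ h
    cases h
  · rintro (⟨t, x⟩ | z)
    · obtain ⟨y, hy⟩ := (hX t).exists_adj x
      exact ⟨_, .base t x y hy⟩
    · exact ⟨_, .down z ⟨0, hr⟩⟩
  · intro f hf hK S hS
    obtain ⟨z, hz⟩ := exists_apex_notMem hrK.le hX hf hK hS
    exact ⟨_, ⟨z, rfl⟩, hz⟩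
  · rintro _ ⟨z, rfl⟩
    obtain ⟨g, hg, hgK, hgle, hgz, hgne⟩ := hcol z
    have hmiss : ∀ w, ∃ c, (∀ t, g t (w t) ≠ c) ∧ c < K ∧ (w = z → c = r) ∧ (w ≠ z → c < r) := by
      intro w
      by_cases hw : w = z
      · refine ⟨r, fun t => ?_, hrK, fun _ => rfl, fun h => absurd hw h⟩
        rw [hw, hgz]
        exact t.isLt.ne
      · obtain ⟨c, hc, hne⟩ := exists_lt_forall_ne hgle w (hgne w hw)
        exact ⟨c, hne, hc.trans hrK, fun h => absurd h hw, fun _ => hc⟩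
    choose β hβ hβK hβz hβw using hmiss
    refine ⟨towerColoring g β, isProper_towerColoring hg hβ, ?_, hβz z rfl, ?_⟩
    · rintro (⟨t, x⟩ | w)
      · exact hgK t x
      · exact hβK w
    · rintro _ ⟨w, rfl⟩ hw
      exact hβw w fun e => hw (e ▸ rfl)
  · have hup : ∀ z t, ∃ f, IsProper ((towerGraph X).deleteEdges {s(.inl ⟨t, z t⟩, .inr z)}) f ∧
        (∀ v, f v < K) ∧ ∀ b ∈ Set.range Sum.inr, f b < r := by
      intro z t
      obtain ⟨g, hg, hgK, hgle, hgz, hgne⟩ := hcol z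
      have hmiss : ∀ w, ∃ c, (∀ t', g t' (w t') = c → w = z ∧ t' = t) ∧ c < r := by
        intro w
        by_cases hw : w = z
        · refine ⟨t, fun t' ht' => ⟨hw, ?_⟩, t.isLt⟩
          rw [hw, hgz] at ht'
          exact Fin.ext ht'
        · obtain ⟨c, hc, hne⟩ := exists_lt_forall_ne hgle w (hgne w hw)
          exact ⟨c, fun t' ht' => absurd ht' (hne t'), hc⟩
      choose β hβ hβr using hmiss
      refine ⟨towerColoring g β, isProper_deleteEdges_towerColoring
        (fun t x y hxy e => absurd e (hg t hxy)) (fun w t' e => ?_), ?_, ?_⟩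
      · obtain ⟨rfl, rfl⟩ := hβ w t' e
        rfl
      · rintro (⟨t, x⟩ | w)
        · exact hgK t x
        · exact (hβr w).trans hrK
      · rintro _ ⟨w, rfl⟩
        exact hβr w
    rintro _ _ (⟨t, x, y, h⟩ | ⟨z, t⟩ | ⟨z, t⟩)
    · have hg : ∀ t' : Fin r, ∃ g : V t' → ℕ, (∀ u v, (X t').Adj u v → g u = g v →
          s((.inl ⟨t', u⟩ : (Σ t, V t) ⊕ (∀ t, V t)), .inl ⟨t', v⟩) =
            s(.inl ⟨t, x⟩, .inl ⟨t, y⟩)) ∧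
          (∀ u, g u < K) ∧ (∀ u, (t' : ℕ) ≤ g u) ∧ (t' = t → ∀ u, g u ≠ t') := by
        intro t'
        by_cases ht : t' = t
        · subst ht
          obtain ⟨g, hg, hgK, hgt⟩ := (hX t').exists_isProper_edge h t'
          refine ⟨g, fun u v huv e => ?_, fun u => (hgK u).trans_eq (by omega),
            fun u => (hgt u).le, fun _ u => (hgt u).ne'⟩
          exact congrArg (Sym2.map fun u => (Sum.inl ⟨t', u⟩ : (Σ t, V t) ⊕ (∀ t, V t)))
            (isProper_deleteEdges_iff.1 hg huv e)
        · obtain ⟨g, hg, hgK, hgle, -, -⟩ := hcol z₀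
          exact ⟨g t', fun u v huv e => absurd e (hg t' huv), hgK t', hgle t',
            fun e => absurd e ht⟩
      choose g hg hgK hgle hgne using hg
      choose β hβr hβ using fun w =>
        exists_lt_forall_ne hgle w ⟨t, hgne t rfl (w t)⟩
      refine ⟨towerColoring g β, isProper_deleteEdges_towerColoring hg
        (fun w t' e => absurd e (hβ w t')), ?_, ?_⟩
      · rintro (⟨t, x⟩ | w)
        · exact hgK t x
        · exact (hβr w).trans hrK
      · rintro _ ⟨w, rfl⟩
        exact hβr w
    · exact hup z t
    · rw [Sym2.eq_swap]
      exact hup z t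

end Tower

/-! ### Joining two forcing sets completely -/

/-- The disjoint union of `G` and `H`, with all edges between `B` and `C` added. -/
def joinGraph (G : SimpleGraph V) (B : Set V) (H : SimpleGraph W) (C : Set W) :
    SimpleGraph (V ⊕ W) where
  Adj
    | .inl u, .inl v => G.Adj u v
    | .inr u, .inr v => H.Adj u v
    | .inl u, .inr v => u ∈ B ∧ v ∈ C
    | .inr u, .inl v => v ∈ B ∧ u ∈ C
  symm := ⟨by
    rintro (u | u) (v | v) h
    exacts [SimpleGraph.Adj.symm h, h, h, SimpleGraph.Adj.symm h]⟩
  loopless := ⟨by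
    rintro (u | u) h
    exacts [G.loopless.irrefl u h, H.loopless.irrefl u h]⟩

section Join

variable {G : SimpleGraph V} {B : Set V} {H : SimpleGraph W} {C : Set W} {K r s : ℕ}

theorem cliqueFree_joinGraph (hG : IsForcing G B K r) (hH : IsForcing H C K s) :
    (joinGraph G B H C).CliqueFree 3 := by
  rw [cliqueFree_three_iff]
  rintro (a | a) (b | b) (c | c) hab hac hbc
  · exact cliqueFree_three_iff.1 hG.cliqueFree a b c hab hac hbc
  · exact hG.indep a hac.1 b hbc.1 hab
  · exact hG.indep a hab.1 c hbc.1 hac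
  · exact hH.indep b hab.2 c hac.2 hbc
  · exact hG.indep b hab.1 c hac.1 hbc
  · exact hH.indep a hab.2 c hbc.2 hac
  · exact hH.indep a hac.2 b hbc.2 hab
  · exact cliqueFree_three_iff.1 hH.cliqueFree a b c hab hac hbc

theorem not_colorable_joinGraph (hG : IsForcing G B K r) (hH : IsForcing H C K s)
    (hK : K ≤ r + s + 1) : ¬ (joinGraph G B H C).Colorable K := by
  classical
  rw [colorable_iff_exists_isProper]
  rintro ⟨f, hf, hfK⟩
  have hr := hG.lt_card_colors (f := f ∘ .inl) (fun u v h => @hf (.inl u) (.inl v) h)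
    (fun v => hfK _) (S := {c ∈ range K | ∃ b ∈ B, f (.inl b) = c})
    fun b hb => mem_filter.2 ⟨mem_range.2 (hfK _), b, hb, rfl⟩
  have hs := hH.lt_card_colors (f := f ∘ .inr) (fun u v h => @hf (.inr u) (.inr v) h)
    (fun v => hfK _) (S := {c ∈ range K | ∃ b ∈ C, f (.inr b) = c})
    fun b hb => mem_filter.2 ⟨mem_range.2 (hfK _), b, hb, rfl⟩
  have hd : Disjoint {c ∈ range K | ∃ b ∈ B, f (.inl b) = c}
      {c ∈ range K | ∃ b ∈ C, f (.inr b) = c} := by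
    rw [disjoint_left]
    intro c hc hc'
    obtain ⟨b, hb, hbc⟩ := (mem_filter.1 hc).2
    obtain ⟨b', hb', hbc'⟩ := (mem_filter.1 hc').2
    exact @hf (.inl b) (.inr b') ⟨hb, hb'⟩ (hbc.trans hbc'.symm)
  have := card_le_card (union_subset (filter_subset (fun c => ∃ b ∈ B, f (.inl b) = c) (range K))
    (filter_subset (fun c => ∃ b ∈ C, f (.inr b) = c) (range K)))
  rw [card_union_of_disjoint hd, card_range] at this
  omega

/-- The colors of the second graph are reversed, so that its forcing set receives large colors. -/
theorem colorable_deleteEdges_joinGraph {f : V → ℕ} {g : W → ℕ} (hf : ∀ v, f v < K)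
    (hg : ∀ v, g v < K) {p q : V ⊕ W}
    (hG : ∀ u v, G.Adj u v → f u = f v → s(.inl u, .inl v) = s(p, q))
    (hH : ∀ u v, H.Adj u v → g u = g v → s(.inr u, .inr v) = s(p, q))
    (hBC : ∀ b ∈ B, ∀ c ∈ C, f b + g c + 1 = K → s(.inl b, .inr c) = s(p, q)) :
    ((joinGraph G B H C).deleteEdges {s(p, q)}).Colorable K := by
  refine colorable_iff_exists_isProper.2 ⟨Sum.elim f fun w => K - 1 - g w, ?_, ?_⟩
  · rw [isProper_deleteEdges_iff]
    rintro (u | u) (v | v) h e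
    · exact hG u v h e
    · have := hf u
      have := hg v
      refine hBC u h.1 v h.2 ?_
      change f u = K - 1 - g v at e
      omega
    · have := hf v
      have := hg u
      rw [Sym2.eq_swap]
      refine hBC v h.1 u h.2 ?_
      change K - 1 - g u = f v at e
      omega
    · have := hg u
      have := hg v
      refine hH u v h ?_
      change K - 1 - g u = K - 1 - g v at e
      omega
  · rintro (v | v)
    · exact hf v
    · have := hg v
      change K - 1 - g v < K
      omega

/-- If the numbers of colors needed by the two sets exceed the number of colors by just one, the
join is critical. -/
theorem isTriangleFreeCritical_joinGraph (hG : IsForcing G B K r) (hH : IsForcing H C K s)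
    (hK : r + s + 1 = K) : IsTriangleFreeCritical (joinGraph G B H C) (K + 1) where
  cliqueFree := cliqueFree_joinGraph hG hH
  not_colorable := not_colorable_joinGraph hG hH hK.ge
  exists_adj := by
    rintro (v | v)
    · obtain ⟨w, hw⟩ := hG.exists_adj v
      exact ⟨.inl w, hw⟩
    · obtain ⟨w, hw⟩ := hH.exists_adj v
      exact ⟨.inr w, hw⟩
  colorable_deleteEdges := by
    rw [Nat.add_sub_cancel]
    have hcross : ∀ b ∈ B, ∀ c ∈ C,
        ((joinGraph G B H C).deleteEdges {s(.inl b, .inr c)}).Colorable K := by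
      intro b hb c hc
      obtain ⟨f, hf, hfK, hfb, hfB⟩ := hG.exists_vertex b hb
      obtain ⟨g, hg, hgK, hgc, hgC⟩ := hH.exists_vertex c hc
      refine colorable_deleteEdges_joinGraph hfK hgK (fun u v h e => absurd e (hf h))
        (fun u v h e => absurd e (hg h)) fun b' hb' c' hc' e => ?_
      by_cases hbb : b' = b <;> by_cases hcc : c' = c
      · rw [hbb, hcc]
      · have := hgC c' hc' hcc
        rw [hbb] at e
        omega
      · have := hfB b' hb' hbb
        rw [hcc] at e
        omega
      · have := hgC c' hc' hcc
        have := hfB b' hb' hbb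
        omega
    rintro (u | u) (v | v) h
    · obtain ⟨f, hf, hfK, hfB⟩ := hG.exists_edge u v h
      obtain ⟨c, hc⟩ := hH.nonempty
      obtain ⟨g, hg, hgK, hgc, hgC⟩ := hH.exists_vertex c hc
      refine colorable_deleteEdges_joinGraph hfK hgK
        (fun x y h e => congrArg (Sym2.map (Sum.inl : V → V ⊕ W)) (isProper_deleteEdges_iff.1 hf h e))
        (fun u v h e => absurd e (hg h)) fun b' hb' c' hc' e => ?_
      have := hfB b' hb'
      have : g c' ≤ s := by
        by_cases hcc : c' = c
        · exact (hcc ▸ hgc).le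
        · exact (hgC c' hc' hcc).le
      omega
    · exact hcross u h.1 v h.2
    · rw [Sym2.eq_swap]
      exact hcross v h.1 u h.2
    · obtain ⟨f, hf, hfK, hfB⟩ := hH.exists_edge u v h
      obtain ⟨c, hc⟩ := hG.nonempty
      obtain ⟨g, hg, hgK, hgc, hgC⟩ := hG.exists_vertex c hc
      refine colorable_deleteEdges_joinGraph hgK hfK (fun u v h e => absurd e (hg h))
        (fun x y h e => congrArg (Sym2.map (Sum.inr : W → V ⊕ W)) (isProper_deleteEdges_iff.1 hf h e))
        fun b' hb' c' hc' e => ?_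
      have := hfB c' hc'
      have : g b' ≤ r := by
        by_cases hcc : b' = c
        · exact (hcc ▸ hgc).le
        · exact (hgC b' hb' hcc).le
      omega

theorem ncard_edgeSet_joinGraph_ge [Finite V] [Finite W] :
    B.ncard * C.ncard + H.edgeSet.ncard ≤ (joinGraph G B H C).edgeSet.ncard := by
  have hBC : ((fun p : V × W => (s(.inl p.1, .inr p.2) : Sym2 (V ⊕ W))) '' B ×ˢ C).ncard =
      B.ncard * C.ncard := by
    rw [Set.ncard_image_of_injective, Set.ncard_prod]
    rintro ⟨a, b⟩ ⟨c, d⟩ h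
    simpa using h
  have hH : (Sym2.map (Sum.inr : W → V ⊕ W) '' H.edgeSet).ncard = H.edgeSet.ncard :=
    Set.ncard_image_of_injective _ (Sym2.map.injective Sum.inr_injective)
  rw [← hBC, ← hH, ← Set.ncard_union_eq]
  · refine Set.ncard_le_ncard (Set.union_subset ?_ ?_)
    · rintro _ ⟨⟨b, c⟩, h, rfl⟩
      exact h
    · rintro _ ⟨e, he, rfl⟩
      induction e with
      | _ u v => exact he
  · rw [Set.disjoint_left]
    rintro _ ⟨⟨b, c⟩, -, rfl⟩ ⟨e, -, he⟩
    induction e with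
    | _ u v => simp at he

end Join

theorem ncard_edgeSet_le_towerGraph {r : ℕ} {V : Fin r → Type*} [∀ t, Fintype (V t)]
    (X : ∀ t, SimpleGraph (V t)) (t : Fin r) :
    (X t).edgeSet.ncard ≤ (towerGraph X).edgeSet.ncard := by
  have hinj : Function.Injective fun x : V t => (Sum.inl ⟨t, x⟩ : (Σ t, V t) ⊕ (∀ t, V t)) :=
    Sum.inl_injective.comp sigma_mk_injective
  rw [← Set.ncard_image_of_injective _ (Sym2.map.injective hinj)]
  refine Set.ncard_le_ncard ?_
  rintro _ ⟨e, he, rfl⟩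
  induction e with
  | _ u v => exact TowerAdj.base t u v he

/-- The join of two towers as a graph on `Fin n`, with its numbers of vertices and edges. -/
theorem exists_isTriangleFreeCritical_of_towers {k r s : ℕ} (hr : 0 < r) (hs : 0 < s)
    (hk : r + s + 2 = k) (X : Fin r → FinGraph)
    (hX : ∀ t : Fin r, IsTriangleFreeCritical (X t).2 (k - 1 - t)) (Y : Fin s → FinGraph)
    (hY : ∀ t : Fin s, IsTriangleFreeCritical (Y t).2 (k - 1 - t)) :
    ∃ G : FinGraph, IsTriangleFreeCritical G.2 k ∧
      G.1 = (∑ t, (X t).1 + ∏ t, (X t).1) + (∑ t, (Y t).1 + ∏ t, (Y t).1) ∧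
      ∀ t, (∏ t, (X t).1) * (∏ t, (Y t).1) + (Y t).2.edgeSet.ncard ≤ G.2.edgeSet.ncard := by
  classical
  have hcrit := isTriangleFreeCritical_joinGraph (K := k - 1)
    (isForcing_towerGraph hr (by omega) hX) (isForcing_towerGraph hs (by omega) hY) (by omega)
  rw [show k - 1 + 1 = k by omega] at hcrit
  set J := joinGraph (towerGraph fun t => (X t).2) (Set.range Sum.inr)
    (towerGraph fun t => (Y t).2) (Set.range Sum.inr)
  refine ⟨⟨_, J.overFin rfl⟩, hcrit.of_iso (J.overFinIso rfl), ?_, fun t => ?_⟩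
  · simp
  · have hle := (ncard_edgeSet_joinGraph_ge (G := towerGraph fun t => (X t).2)
      (B := Set.range Sum.inr) (H := towerGraph fun t => (Y t).2) (C := Set.range Sum.inr))
    have ht := ncard_edgeSet_le_towerGraph (fun t => (Y t).2) t
    have hcard : ∀ {n : ℕ} (Z : Fin n → FinGraph),
        (Set.range (Sum.inr : (∀ t, Fin (Z t).1) → (Σ t, Fin (Z t).1) ⊕ _)).ncard =
          ∏ t, (Z t).1 := by
      intro n Z
      rw [← Set.image_univ, Set.ncard_image_of_injective _ Sum.inr_injective]
      simp [Set.ncard_univ]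
    rw [hcard, hcard] at hle
    change _ ≤ J.edgeSet.ncard at hle
    have hiso : (J.overFin rfl).edgeSet.ncard = J.edgeSet.ncard := by
      rw [← Nat.card_coe_set_eq, ← Nat.card_coe_set_eq]
      exact Nat.card_congr (J.overFinIso rfl).mapEdgeSet.symm
    change _ ≤ (J.overFin rfl).edgeSet.ncard
    rw [hiso]
    omega

/-! ### Numbers of vertices of triangle-free critical graphs -/

theorem IsTriangleFreeCritical.card_pos {G : FinGraph} {k : ℕ}
    (h : IsTriangleFreeCritical G.2 k) : 0 < G.1 :=
  Fin.pos_iff_nonempty.2 h.nonempty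

/-- The sequence of numbers of vertices of triangle-free `k`-critical graphs has bounded gaps. -/
def HasBoundedGaps (k : ℕ) : Prop :=
  ∃ D, ∀ N, ∃ G : FinGraph, IsTriangleFreeCritical G.2 k ∧ N ≤ G.1 ∧ G.1 ≤ N + D

theorem HasBoundedGaps.mul {k : ℕ} (h : HasBoundedGaps k) {a : ℕ} (ha : 0 < a) :
    ∃ D, ∀ N, ∃ G : FinGraph, IsTriangleFreeCritical G.2 k ∧ N ≤ a * G.1 ∧ a * G.1 ≤ N + D := by
  obtain ⟨D, hD⟩ := h
  refine ⟨a * (1 + D), fun N => ?_⟩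
  obtain ⟨G, hG, h1, h2⟩ := hD (N / a + 1)
  refine ⟨G, hG, ?_, ?_⟩
  · calc N ≤ a * (N / a + 1) := (Nat.lt_mul_div_succ N ha).le
      _ ≤ a * G.1 := Nat.mul_le_mul_left a h1
  · calc a * G.1 ≤ a * (N / a + 1 + D) := Nat.mul_le_mul_left a h2
      _ = a * (N / a) + a * (1 + D) := by ring
      _ ≤ N + a * (1 + D) := Nat.add_le_add_right (Nat.mul_div_le N a) _

/-- For `k ≥ 4`, varying one of the graphs in the construction changes the number of vertices
through an affine function. -/
theorem hasBoundedGaps {k : ℕ} (hk : 3 ≤ k) : HasBoundedGaps k := by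
  induction k using Nat.strong_induction_on with
  | _ k ih =>
    rcases hk.eq_or_lt with rfl | hk
    · refine ⟨5, fun N => ⟨⟨_, _⟩, isTriangleFreeCritical_cycleGraph (N / 2), ?_, ?_⟩⟩ <;>
        dsimp only <;> omega
    · obtain ⟨j, rfl⟩ : ∃ j, k = j + 4 := ⟨k - 4, by omega⟩
      have hex : ∀ i, 3 ≤ i → i < j + 4 → ∃ G : FinGraph, IsTriangleFreeCritical G.2 i := by
        intro i hi hij
        obtain ⟨D, hD⟩ := ih i hij hi
        obtain ⟨G, hG, -⟩ := hD 0
        exact ⟨G, hG⟩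
      choose X hX using fun t : Fin j => hex (j + 2 - t) (by omega) (by omega)
      obtain ⟨Y, hY⟩ := hex (j + 3) (by omega) (by omega)
      obtain ⟨D, hD⟩ := (ih (j + 3) (by omega) (by omega)).mul
        (Nat.succ_pos (∏ t, (X t).1))
      refine ⟨D + ∑ t, (X t).1 + 2 * Y.1, fun N => ?_⟩
      obtain ⟨Q, hQ, h1, h2⟩ := hD N
      obtain ⟨G, hG, hn, -⟩ := exists_isTriangleFreeCritical_of_towers (k := j + 4)
        (Nat.succ_pos j) Nat.one_pos (by omega) (Fin.cons (α := fun _ => FinGraph) Q X)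
        (fun t => by
          refine Fin.cases ?_ (fun t => ?_) t
          · exact hQ
          · have : j + 4 - 1 - (t.succ : ℕ) = j + 2 - t := by
              rw [Fin.val_succ]
              omega
            rw [this]
            exact hX t) (fun _ : Fin 1 => Y) (fun t => by
          rw [Fin.val_eq_zero t]
          exact hY)
      simp only [Fin.sum_univ_succ, Fin.prod_univ_succ, Fin.cons_zero, Fin.cons_succ,
        univ_unique, sum_const, card_singleton, one_smul, prod_const, pow_one] at hn
      refine ⟨G, hG, ?_, ?_⟩ <;> rw [hn] <;> simp only [Nat.succ_mul] at h1 h2 <;>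
        simp only [mul_comm Q.1] <;> omega

/-! ### Dense families -/

/-- There are arbitrarily large triangle-free `k`-critical graphs with at most `(b + o(1)) * T`
vertices and at least `a * T ^ 2` edges, for some `T` depending on the graph. -/
def HasDenseFamily (k : ℕ) (a b : ℝ) : Prop :=
  ∀ δ : ℝ, 0 < δ → ∀ M : ℕ, ∃ G : FinGraph, IsTriangleFreeCritical G.2 k ∧ M ≤ G.1 ∧
    ∃ T : ℝ, 0 < T ∧ (G.1 : ℝ) ≤ (b + δ) * T ∧ a * T ^ 2 ≤ G.2.edgeSet.ncard

theorem HasDenseFamily.exists_hasMoreEdges {k : ℕ} {a b c : ℝ} (h : HasDenseFamily k a b)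
    (ha : 0 < a) (hc : c * b ^ 2 < a) (M : ℕ) :
    ∃ G : FinGraph, IsTriangleFreeCritical G.2 k ∧ M ≤ G.1 ∧ HasMoreEdges c G := by
  obtain ⟨δ, hδ, hcδ⟩ : ∃ δ : ℝ, 0 < δ ∧ c * (b + δ) ^ 2 < a := by
    have hcont : Filter.Tendsto (fun δ : ℝ => c * (b + δ) ^ 2) (nhdsWithin 0 (Set.Ioi 0))
        (nhds (c * (b + 0) ^ 2)) :=
      (Continuous.tendsto (by fun_prop) 0).mono_left nhdsWithin_le_nhds
    rw [add_zero] at hcont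
    obtain ⟨δ, h1, h2⟩ := ((hcont.eventually_lt_const hc).and self_mem_nhdsWithin).exists
    exact ⟨δ, h2, h1⟩
  obtain ⟨G, hG, hM, T, hT, hn, he⟩ := h δ hδ M
  refine ⟨G, hG, hM, ?_⟩
  have hT2 : 0 < T ^ 2 := by positivity
  unfold HasMoreEdges
  rcases le_or_gt c 0 with hc0 | hc0
  · calc c * (G.1 : ℝ) ^ 2 ≤ 0 := mul_nonpos_of_nonpos_of_nonneg hc0 (by positivity)
      _ < a * T ^ 2 := by positivity
      _ ≤ _ := he
  · calc c * (G.1 : ℝ) ^ 2 ≤ c * ((b + δ) * T) ^ 2 := by gcongr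
      _ = c * (b + δ) ^ 2 * T ^ 2 := by ring
      _ < a * T ^ 2 := by gcongr
      _ ≤ _ := he

/-- Four sets of equal odd size: two odd cycles, matched to the two sides of a complete bipartite
graph. -/
theorem exists_four_critical (m : ℕ) : ∃ G : FinGraph, IsTriangleFreeCritical G.2 4 ∧
    G.1 = 4 * (2 * m + 5) ∧ (2 * m + 5) ^ 2 ≤ G.2.edgeSet.ncard := by
  have hX : ∀ t : Fin 1,
      IsTriangleFreeCritical (SimpleGraph.cycleGraph (2 * m + 5)) (4 - 1 - t) := by
    intro t
    rw [Fin.val_eq_zero t]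
    exact isTriangleFreeCritical_cycleGraph m
  obtain ⟨G, hG, hn, he⟩ := exists_isTriangleFreeCritical_of_towers (k := 4) Nat.one_pos
    Nat.one_pos rfl (fun _ => ⟨_, SimpleGraph.cycleGraph (2 * m + 5)⟩) hX
    (fun _ => ⟨_, SimpleGraph.cycleGraph (2 * m + 5)⟩) hX
  simp only [univ_unique, sum_const, card_singleton, one_smul, prod_const, pow_one] at hn he
  refine ⟨G, hG, by rw [hn]; ring, ?_⟩
  have := he 0
  rw [sq]
  omega

theorem hasDenseFamily_four : HasDenseFamily 4 1 4 := by
  intro δ hδ M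
  obtain ⟨G, hG, hn, he⟩ := exists_four_critical M
  refine ⟨G, hG, by omega, 2 * M + 5, by positivity, ?_, by rw [one_mul]; exact_mod_cast he⟩
  rw [hn]
  push_cast
  nlinarith [(Nat.cast_nonneg M : (0 : ℝ) ≤ M)]

/-- One side is the product of a 4-critical graph of bounded size and an odd cycle, the other is
matched to a 4-critical graph with `4 * m` vertices and at least `m ^ 2` edges. The sides have about
`15 / 2 * m` and `4 * m` vertices, and the total number of vertices is about `31 / 2 * m`. -/
theorem hasDenseFamily_five : HasDenseFamily 5 31 (31 / 2) := by
  intro δ hδ M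
  -- `P.1 ≥ 15 / δ` bounds the length `Q.1` of the cycle by `δ / 15` times the product `P.1 * Q.1`;
  -- `m` is taken large enough to absorb the terms that depend only on `P`, `D` and `δ`.
  obtain ⟨L, hL⟩ := exists_nat_ge (15 / δ)
  obtain ⟨_, hD₀⟩ := hasBoundedGaps (k := 4) (by norm_num)
  obtain ⟨P, hP, hLP, -⟩ := hD₀ L
  obtain ⟨D, hD⟩ := (hasBoundedGaps (k := 3) le_rfl).mul (a := 2 * P.1)
    (by have := hP.card_pos; omega)
  obtain ⟨m₀, hm₀⟩ := exists_nat_ge (((P.1 : ℝ) + D / 2 + D * δ / 30) * 2 / δ)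
  obtain ⟨Y, hY, hYn, hYe⟩ := exists_four_critical (M + m₀)
  set m := 2 * (M + m₀) + 5 with hm
  obtain ⟨Q, hQ, h1, h2⟩ := hD (15 * m)
  obtain ⟨G, hG, hn, he⟩ := exists_isTriangleFreeCritical_of_towers (k := 5) (r := 2)
    Nat.two_pos Nat.one_pos rfl ![P, Q]
    (fun t => by fin_cases t; exacts [hP, hQ]) (fun _ => Y)
    (fun t => by rw [Fin.val_eq_zero t]; exact hY)
  simp only [Fin.sum_univ_two, Fin.prod_univ_two, Matrix.cons_val_zero, Matrix.cons_val_one,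
    univ_unique, sum_const, card_singleton, one_smul, prod_const, pow_one] at hn he
  have hmpos : (0 : ℝ) < m := by rw [hm]; positivity
  refine ⟨G, hG, by omega, m, hmpos, ?_, ?_⟩
  · have hPL : 15 ≤ δ * P.1 := by
      have : (L : ℝ) ≤ P.1 := by exact_mod_cast hLP
      rw [div_le_iff₀ hδ] at hL
      nlinarith
    have hq : 15 * (Q.1 : ℝ) ≤ δ * P.1 * Q.1 := by gcongr
    have hpq : 2 * (P.1 : ℝ) * Q.1 ≤ 15 * m + D := by exact_mod_cast h2
    have hδpq : δ * (2 * (P.1 : ℝ) * Q.1) ≤ δ * (15 * m + D) := by gcongr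
    have hmm : (m₀ : ℝ) ≤ m := by
      have : m₀ ≤ m := by omega
      exact_mod_cast this
    have hsmall : ((P.1 : ℝ) + D / 2 + D * δ / 30) * 2 ≤ m * δ := by
      rw [div_le_iff₀ hδ] at hm₀
      exact hm₀.trans (by gcongr)
    rw [hn, hYn]
    push_cast
    nlinarith
  · have he0 := he 0
    have h1' : 15 * m * (2 * m) ≤ 2 * P.1 * Q.1 * (2 * m) := Nat.mul_le_mul_right _ h1
    have : 31 * m ^ 2 ≤ G.2.edgeSet.ncard := by
      rw [show P.1 * Q.1 * Y.1 = P.1 * Q.1 * (4 * m) by rw [hYn]] at he0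
      nlinarith
    exact_mod_cast this

theorem mul_le_prod_of_forall_le {s N : ℕ} (hs : 2 ≤ s) {a : Fin s → ℕ} (hN : 0 < N)
    (ha : ∀ t, N ≤ a t) (t : Fin s) : N * a t ≤ ∏ t, a t := by
  obtain ⟨t', ht'⟩ : ∃ t' : Fin s, t' ≠ t := by
    have : Nontrivial (Fin s) := Fin.nontrivial_iff_two_le.2 hs
    exact exists_ne t
  rw [← mul_prod_erase univ a (mem_univ t), mul_comm]
  exact Nat.mul_le_mul_left _ ((ha t').trans (single_le_prod' (f := a)
    (fun i _ => hN.trans_le (ha i)) (mem_erase.2 ⟨ht', mem_univ _⟩)))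

/-- Both sides are products of at least two graphs, so that the complete bipartite graph contains
almost all vertices; bounded gaps make it almost balanced. -/
theorem hasDenseFamily_of_six_le {k : ℕ} (hk : 6 ≤ k) : HasDenseFamily k 1 2 := by
  intro δ hδ M
  -- The error terms `Q.1`, `∑ t, (Y t).1` and the terms that depend only on `P`, `D` and `δ` amount
  -- to at most `δ / 4`, `δ / 4` and `δ / 2` times `R`, up to the bounded excess of `P.1 * Q.1`.
  obtain ⟨L, hL⟩ := exists_nat_ge (4 / δ)
  obtain ⟨_, hD₀⟩ := hasBoundedGaps (k := k - 1) (by omega)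
  obtain ⟨P, hP, hLP, -⟩ := hD₀ L
  obtain ⟨D, hD⟩ := (hasBoundedGaps (k := k - 2) (by omega)).mul hP.card_pos
  obtain ⟨N₀, hN₀⟩ := exists_nat_ge (((P.1 : ℝ) + D + δ / 4 * D) * 2 / δ)
  obtain ⟨N₁, hN₁⟩ := exists_nat_ge (4 * (k - 4 : ℕ) / δ)
  set N := M + N₀ + N₁ + 1 with hN
  have hYex : ∀ t : Fin (k - 4), ∃ G : FinGraph,
      IsTriangleFreeCritical G.2 (k - 1 - t) ∧ N ≤ G.1 := by
    intro t
    obtain ⟨_, h⟩ := hasBoundedGaps (k := k - 1 - t) (by omega)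
    obtain ⟨G, hG, hNG, -⟩ := h N
    exact ⟨G, hG, hNG⟩
  choose Y hY hNY using hYex
  set R := ∏ t, (Y t).1 with hR
  have hNR : ∀ t, N * (Y t).1 ≤ R := mul_le_prod_of_forall_le (by omega) (by omega) hNY
  have t₀ : Fin (k - 4) := ⟨0, by omega⟩
  have hNle : N ≤ R :=
    (Nat.le_mul_of_pos_right N (hY t₀).card_pos).trans (hNR t₀)
  have hsum : N * ∑ t, (Y t).1 ≤ (k - 4) * R := by
    rw [mul_sum]
    refine (sum_le_sum fun t _ => hNR t).trans ?_
    simp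
  obtain ⟨Q, hQ, h1, h2⟩ := hD R
  obtain ⟨G, hG, hn, he⟩ := exists_isTriangleFreeCritical_of_towers (k := k) (r := 2)
    (s := k - 4) Nat.two_pos (by omega) (by omega) ![P, Q]
    (fun t => by
      fin_cases t
      · exact hP
      · have : k - 1 - 1 = k - 2 := by omega
        exact this.symm ▸ hQ) Y hY
  simp only [Fin.sum_univ_two, Fin.prod_univ_two, Matrix.cons_val_zero, Matrix.cons_val_one,
    ← hR] at hn he
  have hNR' : (N : ℝ) ≤ R := by exact_mod_cast hNle
  have hNpos : (0 : ℝ) < N := by rw [hN]; positivity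
  refine ⟨G, hG, by omega, R, hNpos.trans_le hNR', ?_, ?_⟩
  · have hPL : 4 ≤ δ * P.1 := by
      have : (L : ℝ) ≤ P.1 := by exact_mod_cast hLP
      rw [div_le_iff₀ hδ] at hL
      nlinarith
    have hq : 4 * (Q.1 : ℝ) ≤ δ * P.1 * Q.1 := by gcongr
    have hpq : (P.1 : ℝ) * Q.1 ≤ R + D := by exact_mod_cast h2
    have hδpq : δ * ((P.1 : ℝ) * Q.1) ≤ δ * (R + D) := by gcongr
    have hsmall : ((P.1 : ℝ) + D + δ / 4 * D) * 2 ≤ R * δ := by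
      rw [div_le_iff₀ hδ] at hN₀
      have : (N₀ : ℝ) ≤ N := by
        have : N₀ ≤ N := by omega
        exact_mod_cast this
      exact hN₀.trans (mul_le_mul_of_nonneg_right (this.trans hNR') hδ.le)
    have hσ : 4 * ∑ t, ((Y t).1 : ℝ) ≤ δ * R := by
      have hkN : 4 * ((k - 4 : ℕ) : ℝ) ≤ N * δ := by
        rw [div_le_iff₀ hδ] at hN₁
        have : (N₁ : ℝ) ≤ N := by
          have : N₁ ≤ N := by omega
          exact_mod_cast this
        exact hN₁.trans (by gcongr)
      have hsum' : (N : ℝ) * ∑ t, ((Y t).1 : ℝ) ≤ (k - 4 : ℕ) * R := by exact_mod_cast hsum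
      refine le_of_mul_le_mul_left ?_ hNpos
      calc (N : ℝ) * (4 * ∑ t, ((Y t).1 : ℝ)) = 4 * (N * ∑ t, ((Y t).1 : ℝ)) := by ring
        _ ≤ 4 * ((k - 4 : ℕ) * R) := by gcongr
        _ = (4 * (k - 4 : ℕ)) * R := by ring
        _ ≤ (N * δ) * R := by gcongr
        _ = N * (δ * R) := by ring
    rw [hn]
    push_cast
    nlinarith
  · have he0 := he t₀
    have : R ^ 2 ≤ G.2.edgeSet.ncard := by
      have := Nat.mul_le_mul_right R h1
      nlinarith
    rw [one_mul]
    exact_mod_cast this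

/-! ### The density constants -/

theorem three_lt_oddGirth_iff {V : Type*} {G : SimpleGraph V} :
    ((3 : ℕ) : ℕ∞) < oddGirth G ↔ G.CliqueFree 3 := by
  constructor
  · intro h s hs
    obtain ⟨u, w, hw, hlen⟩ :=
      SimpleGraph.is3Clique_iff_exists_cycle_length_three.1 ⟨s, hs⟩
    have hodd : Odd w.length := hlen ▸ by decide
    have hle : oddGirth G ≤ (w.length : ℕ∞) :=
      iInf_le_of_le u (iInf_le_of_le w (iInf_le_of_le hw (iInf_le_of_le hodd le_rfl)))
    rw [hlen] at hle
    exact h.not_ge hle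
  · intro h
    refine lt_of_lt_of_le (b := ((4 : ℕ) : ℕ∞)) (by norm_num) ?_
    refine le_iInf₂ fun u w => le_iInf₂ fun hw _ => Nat.cast_le.2 ?_
    have h3 := hw.three_le_length
    have : w.length ≠ 3 := fun hlen => by
      obtain ⟨s, hs⟩ := SimpleGraph.is3Clique_iff_exists_cycle_length_three.2 ⟨u, w, hw, hlen⟩
      exact h s hs
    omega

/-- Mantel's theorem. -/
theorem four_mul_ncard_edgeSet_le {n : ℕ} {G : SimpleGraph (Fin n)} (h : G.CliqueFree 3) :
    4 * G.edgeSet.ncard ≤ n ^ 2 := by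
  classical
  have := SimpleGraph.CliqueFree.card_edgeFinset_le (r := 2) h
  have hc : (n % 2).choose 2 = 0 := Nat.choose_eq_zero_of_lt (Nat.mod_lt _ (by norm_num))
  simp only [Fintype.card_fin, hc] at this
  rw [← SimpleGraph.coe_edgeFinset, Set.ncard_coe_finset]
  omega

theorem le_of_mem_densitySet {k : ℕ} {c : ℝ} (hc : c ∈ densitySet 3 k) : c ≤ 1 / 4 := by
  obtain ⟨F, hF, hG⟩ := hc
  obtain ⟨G, hGF⟩ := hF.nonempty
  obtain ⟨-, hgirth, he⟩ := hG G hGF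
  have hM : 4 * (G.2.edgeSet.ncard : ℝ) ≤ (G.1 : ℝ) ^ 2 := by
    exact_mod_cast four_mul_ncard_edgeSet_le (three_lt_oddGirth_iff.1 hgirth)
  unfold HasMoreEdges at he
  by_contra! hlt
  nlinarith [sq_nonneg (G.1 : ℝ)]

theorem bddAbove_densitySet (k : ℕ) : BddAbove (densitySet 3 k) :=
  ⟨1 / 4, fun _ => le_of_mem_densitySet⟩

theorem infinite_of_forall_exists_le {F : Set FinGraph} (h : ∀ M, ∃ G ∈ F, M ≤ G.1) :
    F.Infinite := by
  refine Set.Infinite.of_image Sigma.fst (Set.infinite_of_not_bddAbove ?_)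
  rintro ⟨M, hM⟩
  obtain ⟨G, hG, hle⟩ := h (M + 1)
  have := hM ⟨G, hG, rfl⟩
  omega

theorem HasDenseFamily.mem_densitySet {k : ℕ} {a b c : ℝ} (h : HasDenseFamily k a b)
    (ha : 0 < a) (hc : c * b ^ 2 < a) : c ∈ densitySet 3 k := by
  refine ⟨{G | IsTriangleFreeCritical G.2 k ∧ HasMoreEdges c G},
    infinite_of_forall_exists_le fun M => ?_, fun G hG => ⟨hG.1.isKCritical,
      three_lt_oddGirth_iff.2 hG.1.cliqueFree, hG.2⟩⟩
  obtain ⟨G, hG, hM, he⟩ := h.exists_hasMoreEdges ha hc M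
  exact ⟨G, ⟨hG, he⟩, hM⟩

theorem HasDenseFamily.le_densityConst {k : ℕ} {a b : ℝ} (h : HasDenseFamily k a b)
    (ha : 0 < a) (hb : 0 < b) : a / b ^ 2 ≤ densityConst 3 k :=
  le_of_forall_lt fun c hc => by
    obtain ⟨c', hcc', hc'⟩ := exists_between hc
    exact hcc'.trans_le (le_csSup (bddAbove_densitySet k)
      (h.mem_densitySet ha ((lt_div_iff₀ (by positivity)).1 hc')))

/-- Every `k ≥ 4` has a dense family of density greater than `1 / 20`. -/
theorem exists_hasDenseFamily {k : ℕ} (hk : 4 ≤ k) :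
    ∃ a b : ℝ, 0 < a ∧ 1 / 20 * b ^ 2 < a ∧ HasDenseFamily k a b := by
  obtain rfl | rfl | hk : k = 4 ∨ k = 5 ∨ 6 ≤ k := by omega
  · exact ⟨1, 4, by norm_num, by norm_num, hasDenseFamily_four⟩
  · exact ⟨31, 31 / 2, by norm_num, by norm_num, hasDenseFamily_five⟩
  · exact ⟨1, 2, by norm_num, by norm_num, hasDenseFamily_of_six_le hk⟩

end CriticalDensity

theorem theorem1 :
    -- one dense family of triangle-free critical graphs, with infinitely many `k`-chromatic members
    -- for each `k ≥ 4`
    (∃ c : ℝ, 0 < c ∧ ∃ F : Set CriticalDensity.FinGraph,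
      (∀ G ∈ F, G.2.CliqueFree 3 ∧ (∃ k : ℕ, CriticalDensity.IsKCritical G.2 k) ∧
        CriticalDensity.HasMoreEdges c G) ∧
      ∀ k : ℕ, 4 ≤ k → {G ∈ F | G.2.chromaticNumber = (k : ℕ∞)}.Infinite) ∧
    -- the suprema that define the density constants `c_k` exist
    (∀ k : ℕ, 4 ≤ k →
      IsLUB (CriticalDensity.densitySet 3 k) (CriticalDensity.densityConst 3 k)) ∧
    (1 / 16 : ℝ) ≤ CriticalDensity.densityConst 3 4 ∧
    (4 / 31 : ℝ) ≤ CriticalDensity.densityConst 3 5 ∧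
    ∀ k : ℕ, 6 ≤ k → CriticalDensity.densityConst 3 k = 1 / 4 := by
  open CriticalDensity in
  have hmem : ∀ k, 4 ≤ k → (1 / 20 : ℝ) ∈ densitySet 3 k := fun k hk => by
    obtain ⟨a, b, ha, hab, h⟩ := exists_hasDenseFamily hk
    exact h.mem_densitySet ha hab
  refine ⟨⟨1 / 20, by norm_num, {G | G.2.CliqueFree 3 ∧ (∃ k : ℕ, IsKCritical G.2 k) ∧
    HasMoreEdges (1 / 20) G}, fun G hG => hG, fun k hk => ?_⟩, fun k hk => ?_, ?_, ?_, ?_⟩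
  · obtain ⟨F, hF, hG⟩ := hmem k hk
    refine hF.mono fun G hGF => ?_
    obtain ⟨hcrit, hgirth, he⟩ := hG G hGF
    exact ⟨⟨three_lt_oddGirth_iff.1 hgirth, ⟨k, hcrit⟩, he⟩, hcrit.1⟩
  · exact isLUB_csSup ⟨_, hmem k hk⟩ (bddAbove_densitySet k)
  · have := hasDenseFamily_four.le_densityConst (by norm_num) (by norm_num)
    norm_num at this ⊢
    exact this
  · have := hasDenseFamily_five.le_densityConst (by norm_num) (by norm_num)
    norm_num at this ⊢
    exact this
  · intro k hk
    refine le_antisymm (csSup_le ⟨_, hmem k (by omega)⟩ fun c => le_of_mem_densitySet) ?_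
    have := (hasDenseFamily_of_six_le hk).le_densityConst (by norm_num) (by norm_num)
    norm_num at this ⊢
    exact this
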